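/- **Setting.** Let $(\mathcal X,\Sigma_{\mathcal X})$ be a measurable space, $\mu$ a probability measure on $\mathcal X$, $\mathcal A$ a normed space with its Borel $\sigma$-algebra, $A:\mathcal X\to\mathcal A$ measurable and $a\in\mathcal A$. Let $\infty=\delta_0>\delta_1>\dots>\delta_m>0$. For $\delta\in(0,\infty]$ put $$\mathcal X_\delta^a=\{x\in\mathcal X:\|A(x)-a\|_{\mathcal A}<\delta\},\qquad \mu_\delta^a(\mathrm dx)=\frac1{Z_\delta^a}\,\phi\!\left(\frac{\|A(x)-a\|_{\mathcal A}}{\delta}\right)\mu(\mathrm dx),\qquad \phi(r)=1[r<1],$$ where $Z_\delta^a=\int\phi(\|\tilde a-a\|_{\mathcal A}/\delta)\,A_\#\mu(\mathrm d\tilde a)$, so that $\mathcal X^a_{\delta_0}=\mathcal X$ and $\mu^a_{\delta_0}=\mu$. Let $\mathcal F$ be a linear space of measurable functions $f:\mathcal X\to\mathbb R$ with a norm $\|\cdot\|_{\mathcal F}$ such that $\|f\|_\infty\le C_{\mathcal F}\|f\|_{\mathcal F}$ for all $f\in\mathcal F$ and some constant $C_{\mathcal F}$. **Kernels.** Let $\epsilon_0,\dots,\epsilon_{m-1}>0$,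 and let $K_1,\dots,K_m$ be Markov transition kernels on $\mathcal X$ such that, for all $i=0,\dots,m-1$: 1. $K_{i+1}$ leaves $\mu^a_{\delta_i}$ invariant; 2. (reachability) $K_{i+1}(x,\mathcal X^a_{\delta_{i+1}})>0$ for all $x\in\mathcal X^a_{\delta_i}$; 3. (minorisation) for all $x,y\in\mathcal X^a_{\delta_i}$, $K_{i+1}(x,\cdot)\ll K_{i+1}(y,\cdot)$ and $\dfrac{\mathrm dK_{i+1}(x,\cdot)}{\mathrm dK_{i+1}(y,\cdot)}\ge\epsilon_i$ holds $K_{i+1}(y,\cdot)$-almost everywhere. **Algorithm (SMC-ND with $P\ge1$ particles).** Draw $x_1^0,\dots,x_P^0$ independently from $\mu$. For $i=1,\dots,m$: draw $x_j^i\sim K_i(x_j^{i-1},\cdot)$ independently for $j=1,\dots,P$; if none of these particles lies in $\mathcal X^a_{\delta_i}$, the algorithm fails and stops; otherwise, independently for each $j$ with $x_j^i\notin\mathcal X^a_{\delta_i}$, replace $x_j^i$ by a particle chosen uniformly among those particles that lie in $\mathcal X^a_{\delta_i}$. For $0\le i\le m$ set $\mu^a_{\delta_i,P}(f)=\frac1P\sum_{j=1}^Pf(x_j^i)$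 if the algorithm has not failed by the end of iteration $i$, and $\mu^a_{\delta_i,P}(f)=0$ otherwise. **Theorem.** For every fixed real $p\ge1$ there is a constant $C_p$ such that for all $\delta\in\{\delta_i\}_{i=0}^m$, all $P\ge1$ and all $f\in\mathcal F$, $$\mathbb E\left(\left|\mu^a_{\delta,P}(f)-\mu^a_\delta(f)\right|^p\right)^{1/p}\le\frac{C_p\,\|f\|_{\mathcal F}}{\sqrt P}$$ (and the expectation is finite). With $\mathcal X,\mu,A,a,\mathcal F$ fixed, $C_p$ depends only on $p$, $\{\delta_i\}_{i=0}^m$ and $\{\epsilon_i\}_{i=0}^{m-1}$; it does not depend on $P$, $f$, $\delta$ or otherwise on the kernels $K_i$. -/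

import Mathlib

open MeasureTheory ProbabilityTheory
open scoped ENNReal NNReal

noncomputable section

namespace SMCND

/-! ### The relaxed posterior -/

section Relaxation

variable {X 𝒜 : Type*} [MeasurableSpace X] [NormedAddCommGroup 𝒜] [MeasurableSpace 𝒜]

/-- The weight `φ (‖b - a‖ / δ)`. The bandwidth `δ = ∞` is allowed and gives `φ 0`. -/
def relaxWeight (φ : ℝ≥0 → ℝ≥0) (a : 𝒜) (δ : ℝ≥0∞) (b : 𝒜) : ℝ≥0∞ :=
  φ (‖b - a‖ₑ / δ).toNNReal

/-- The normalisation constant: the integral of the weight `φ (‖b - a‖ / δ)` against the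
push-forward of `μ` under `A`. -/
def normConst (φ : ℝ≥0 → ℝ≥0) (μ : Measure X) (A : X → 𝒜) (a : 𝒜) (δ : ℝ≥0∞) : ℝ≥0∞ :=
  ∫⁻ b, relaxWeight φ a δ b ∂(μ.map A)

/-- The relaxed posterior `μ_δ^a (dx) = Z⁻¹ φ (‖A x - a‖ / δ) μ (dx)`. -/
def relaxedPosterior (φ : ℝ≥0 → ℝ≥0) (μ : Measure X) (A : X → 𝒜) (a : 𝒜) (δ : ℝ≥0∞) :
    Measure X :=
  (normConst φ μ A a δ)⁻¹ • μ.withDensity fun x => relaxWeight φ a δ (A x)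

/-- The indicator relaxation function `φ r = 1[r < 1]`. -/
def indicatorPhi (r : ℝ≥0) : ℝ≥0 := if r < 1 then 1 else 0

/-- The set of states `x` with `‖A x - a‖ < δ`. -/
def dataBall (A : X → 𝒜) (a : 𝒜) (δ : ℝ≥0∞) : Set X := {x | ‖A x - a‖ₑ < δ}

theorem measurableSet_dataBall [BorelSpace 𝒜] {A : X → 𝒜} (hA : Measurable A) (a : 𝒜)
    (δ : ℝ≥0∞) : MeasurableSet (dataBall A a δ) := by
  have h : Measurable fun b : 𝒜 => ‖b - a‖ₑ :=
    (continuous_enorm.comp (continuous_id.sub continuous_const)).measurable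
  exact measurableSet_lt (h.comp hA) measurable_const

end Relaxation

/-! ### The particle algorithm -/

section Algorithm

variable {X : Type*} [MeasurableSpace X] {P : ℕ}

/-- A family of laws on populations whose values on boxes are measurable is measurable. -/
theorem measurable_pi_of_apply {Y : Type*} [MeasurableSpace Y] (ν : Y → Fin P → Measure X)
    [∀ y j, IsFiniteMeasure (ν y j)]
    (h : ∀ (j : Fin P) (B : Set X), MeasurableSet B → Measurable fun y => ν y j B) :
    Measurable fun y => Measure.pi (ν y) := by
  refine Measurable.measure_of_isPiSystem generateFrom_pi.symm isPiSystem_pi ?_ ?_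
  · rintro _ ⟨t, ht, rfl⟩
    simp only [Measure.pi_pi]
    exact Finset.measurable_prod _ fun j _ => h j (t j) (ht j (Set.mem_univ j))
  · simp only [Measure.pi_univ]
    exact Finset.measurable_prod _ fun j _ => h j _ MeasurableSet.univ

/-- The move step: each particle is moved by `K`, independently of the others. -/
def moveKernel (P : ℕ) (K : Kernel X X) [IsMarkovKernel K] :
    Kernel (Fin P → X) (Fin P → X) where
  toFun x := Measure.pi fun j => K (x j)
  measurable' := measurable_pi_of_apply (fun (x : Fin P → X) j => K (x j)) fun j _ hB =>
    (K.measurable_coe hB).comp (measurable_pi_apply j)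

open scoped Classical in
/-- The indices of the particles of the population `y` that lie in `S`. -/
def survivors (S : Set X) (y : Fin P → X) : Finset (Fin P) := {k | y k ∈ S}

open scoped Classical in
/-- The law of the `j`-th particle after re-sampling the population `y`: it is kept if it lies
in `S`, and otherwise replaced by a uniformly chosen particle among those that lie in `S`. -/
def resampleLaw (S : Set X) (y : Fin P → X) (j : Fin P) : Measure X :=
  if y j ∈ S then Measure.dirac (y j)
  else ((survivors S y).card : ℝ≥0∞)⁻¹ • ∑ k ∈ survivors S y, Measure.dirac (y k)

instance (S : Set X) (y : Fin P → X) (j : Fin P) : IsFiniteMeasure (resampleLaw S y j) := by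
  unfold resampleLaw
  split_ifs
  · infer_instance
  · rcases (survivors S y).eq_empty_or_nonempty with h | h
    · simp only [h, Finset.sum_empty, smul_zero]
      infer_instance
    · refine Measure.smul_finite _ ?_
      simp [h.ne_empty]

theorem measurable_resampleLaw {S : Set X} (hS : MeasurableSet S) (j : Fin P) (B : Set X)
    (hB : MeasurableSet B) : Measurable fun y : Fin P → X => resampleLaw S y j B := by
  classical
  have hm : ∀ (T : Set X), MeasurableSet T → ∀ k : Fin P,
      MeasurableSet {y : Fin P → X | y k ∈ T} := fun T hT k => measurable_pi_apply k hT
  have hd : ∀ k : Fin P, Measurable fun y : Fin P → X => Measure.dirac (y k) B := fun k =>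
    (Measure.measurable_coe hB).comp (Measure.measurable_dirac.comp (measurable_pi_apply k))
  have hc : Measurable fun y : Fin P → X => ((survivors S y).card : ℝ≥0∞) := by
    simp only [survivors, Finset.card_filter, Nat.cast_sum, Nat.cast_ite, Nat.cast_one,
      Nat.cast_zero]
    exact Finset.measurable_sum _ fun k _ =>
      Measurable.ite (hm S hS k) measurable_const measurable_const
  have hs : Measurable fun y : Fin P → X => ∑ k ∈ survivors S y, Measure.dirac (y k) B := by
    simp only [survivors, Finset.sum_filter]
    exact Finset.measurable_sum _ fun k _ => Measurable.ite (hm S hS k) (hd k) measurable_const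
  have he : (fun y : Fin P → X => resampleLaw S y j B) = fun y => if y j ∈ S then
      Measure.dirac (y j) B
      else ((survivors S y).card : ℝ≥0∞)⁻¹ * ∑ k ∈ survivors S y, Measure.dirac (y k) B := by
    funext y
    unfold resampleLaw
    split_ifs
    · rfl
    · simp only [Measure.smul_apply, Measure.finsetSum_apply, smul_eq_mul]
  rw [he]
  exact Measurable.ite (hm S hS j) (hd j) (hc.inv.mul hs)

/-- The re-sampling of a population `y` with at least one particle in `S`, independently
over the particles. -/
def resampleKernel (P : ℕ) (S : Set X) (hS : MeasurableSet S) :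
    Kernel (Fin P → X) (Fin P → X) where
  toFun y := Measure.pi fun j => resampleLaw S y j
  measurable' := measurable_pi_of_apply (fun (y : Fin P → X) j => resampleLaw S y j) fun j B hB =>
    measurable_resampleLaw hS j B hB

/-- The states of the algorithm: `Sum.inl ()` if it has failed, and `Sum.inr x` if its
population of particles is `x`. -/
abbrev State (X : Type*) (P : ℕ) : Type _ := Unit ⊕ (Fin P → X)

theorem measurableSet_hit {S : Set X} (hS : MeasurableSet S) :
    MeasurableSet {y : Fin P → X | ∃ j, y j ∈ S} := by
  have h : {y : Fin P → X | ∃ j, y j ∈ S} = ⋃ j, (fun y : Fin P → X => y j) ⁻¹' S := by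
    ext y
    simp
  rw [h]
  exact MeasurableSet.iUnion fun j => measurable_pi_apply j hS

open scoped Classical in
/-- The selection step: fail if no particle lies in `S`, and re-sample otherwise. -/
def selectKernel (P : ℕ) (S : Set X) (hS : MeasurableSet S) :
    Kernel (Fin P → X) (State X P) :=
  Kernel.piecewise (measurableSet_hit hS) ((resampleKernel P S hS).map Sum.inr)
    (Kernel.const _ (Measure.dirac (Sum.inl ())))

/-- One iteration: a failed run stays failed; otherwise the particles are moved by `K` and then
undergo selection with respect to `S`. -/
def stepKernel (P : ℕ) (K : Kernel X X) [IsMarkovKernel K] (S : Set X) (hS : MeasurableSet S) :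
    Kernel (State X P) (State X P) where
  toFun := Sum.elim (fun _ => Measure.dirac (Sum.inl ()))
    (selectKernel P S hS ∘ₖ moveKernel P K)
  measurable' := Measurable.sumElim measurable_const (Kernel.measurable _)

/-- The law of the state of the algorithm with `P` particles after `i` iterations. It starts from
`P` independent draws from `μ`; iteration `i + 1` moves by `K i` and selects by `S (i + 1)`. -/
def smcLaw (P : ℕ) (μ : Measure X) {m : ℕ} (K : Fin m → Kernel X X) [∀ i, IsMarkovKernel (K i)]
    (S : Fin (m + 1) → Set X) (hS : ∀ i, MeasurableSet (S i)) :
    Fin (m + 1) → Measure (State X P) :=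
  Fin.induction ((Measure.pi fun _ => μ).map Sum.inr)
    fun i law => law.bind (stepKernel P (K i) (S i.succ) (hS i.succ))

/-- The output of the algorithm for the integrand `f`: the average of `f` over the particles,
and `0` if the algorithm has failed. -/
def smcEstimate (f : X → ℝ) : State X P → ℝ
  | Sum.inl _ => 0
  | Sum.inr x => (∑ j, f (x j)) / P

end Algorithm

end SMCND

end

/-!
The argument follows the `p`-th power error `E |μ_{i,P}(f) - μ_i(f)| ^ p` through the ladder,
uniformly over all measurable `f` with `|f| ≤ 1`. This class, unlike the given space of test
functions, is stable under the operations that an iteration applies to the integrand: multiplication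
by an indicator and integration against a Markov kernel.

For the indicator relaxation function the target `μ_i` is `μ` conditioned on the `i`-th data ball
(`relaxedPosterior_indicatorPhi_eq_cond`), so `μ_{i+1}` is `μ_i` conditioned on the next ball `S`.
An iteration has three sources of error.

* Moving and re-sampling both draw independent particles given the current population. Hoeffding's
  lemma makes the centred sum sub-Gaussian with variance proxy `P`, so its `p`-th moment is at most a
  constant times `P ^ (p / 2)` (`lintegral_mean_sub_rpow_le`).
* Given the moved population, the mean of the re-sampled empirical measure at `f` is exactly the
  ratio of the empirical means of `1_S f` and `1_S` (`sum_integral_resampleLaw`), whereas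
  `μ_{i+1}(f)` is the ratio of `μ_i(1_S f)` and `μ_i(1_S)`. Since the empirical ratio is at most `1`
  in absolute value, its error is controlled by the errors of numerator and denominator divided by
  `μ_i(S)` alone (`abs_ratio_sub_le`). In the event that no particle lies in `S`, the empirical ratio
  is `0 / 0 = 0`, which is the value of the estimate after a failure, so failure needs no separate
  probability bound.
* A run that has failed earlier has error `1` at the integrand `1`, which dominates the error of its
  output at `f`; hence these runs are accounted for by the previous error bound.

By invariance the empirical mean of `g` after the move has conditional mean the empirical mean of
`K g`, and `μ_i(K g) = μ_i(g)`, so the previous bound applies to `K (1_S f)` and `K 1_S`. The constant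
grows by `stepConst`, in which the kernels do not appear (`lintegral_bind_stepKernel_le`). Invariance
and reachability give `μ_i(S) > 0`, which makes it finite (`exists_lintegral_smcLaw_le`). Scaling
passes from `|f| ≤ 1` to `|f| ≤ C_F ‖f‖_F` (`integral_rpow_le_of_lintegral_le`).
-/

namespace SMCND

/-! ### Moments of averages of independent variables -/

/-- The `p`-th power of the Monte Carlo rate `1 / √P`. -/
noncomputable def mcRate (p : ℝ) (P : ℕ) : ℝ≥0∞ := ENNReal.ofReal ((√(P : ℝ))⁻¹ ^ p)

/-- The constant in the `p`-th moment bound for averages of independent variables with values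
in `[-1, 1]`. -/
noncomputable def momentConst (p : ℝ) : ℝ≥0 := (2 * Real.exp (1 / 2) * p ^ p).toNNReal

section Moment

variable {X : Type*} [MeasurableSpace X] {P : ℕ}

theorem integrable_of_abs_le_one {ν : Measure X} [IsFiniteMeasure ν] {g : X → ℝ}
    (hg : Measurable g) (hg1 : ∀ x, |g x| ≤ 1) : Integrable g ν :=
  Integrable.of_bound hg.aestronglyMeasurable 1 (.of_forall hg1)

theorem abs_integral_le_one {ν : Measure X} [IsProbabilityMeasure ν] {g : X → ℝ}
    (hg1 : ∀ x, |g x| ≤ 1) : |∫ x, g x ∂ν| ≤ 1 := by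
  simpa using norm_integral_le_of_norm_le_const (μ := ν) (f := g) (C := 1) (.of_forall hg1)

/-- The sum of `P` centred independent variables with values in `[-1, 1]` is sub-Gaussian with
variance proxy `P`, by Hoeffding's lemma. -/
theorem hasSubgaussianMGF_sum_sub_integral (ν : Fin P → Measure X)
    [∀ j, IsProbabilityMeasure (ν j)] {g : X → ℝ} (hg : Measurable g) (hg1 : ∀ x, |g x| ≤ 1) :
    HasSubgaussianMGF (fun y : Fin P → X => ∑ j, (g (y j) - ∫ x, g x ∂ν j)) P
      (Measure.pi ν) := by
  have hind : iIndepFun (fun j (y : Fin P → X) => g (y j) - ∫ x, g x ∂ν j) (Measure.pi ν) :=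
    iIndepFun_pi (X := fun j x => g x - ∫ x, g x ∂ν j) fun j => (hg.sub_const _).aemeasurable
  have hsub : ∀ j ∈ (Finset.univ : Finset (Fin P)),
      HasSubgaussianMGF (fun y : Fin P → X => g (y j) - ∫ x, g x ∂ν j) 1 (Measure.pi ν) := by
    intro j _
    have h := hasSubgaussianMGF_of_mem_Icc (μ := Measure.pi ν) (X := fun y : Fin P → X => g (y j))
      (a := -1) (b := 1) (hg.comp (measurable_pi_apply j)).aemeasurable
      (.of_forall fun y => abs_le.1 (hg1 (y j)))
    rw [integral_comp_eval (μ := ν) (f := g) hg.aestronglyMeasurable] at h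
    have hc : (‖(1 : ℝ) - -1‖₊ / 2) ^ 2 = (1 : ℝ≥0) := by
      ext
      norm_num
    rwa [hc] at h
  simpa using HasSubgaussianMGF.sum_of_iIndepFun hind hsub

/-- The `p`-th moment of the fluctuation of an empirical mean of `P` independent draws around its
mean is of order `P ^ (-p / 2)`; the laws of the draws may differ. -/
theorem lintegral_mean_sub_rpow_le (hP : 0 < P) (ν : Fin P → Measure X)
    [∀ j, IsProbabilityMeasure (ν j)] {g : X → ℝ} (hg : Measurable g) (hg1 : ∀ x, |g x| ≤ 1)
    {p : ℝ} (hp : 0 < p) :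
    ∫⁻ y, ‖(∑ j, g (y j)) / P - (∑ j, ∫ x, g x ∂ν j) / P‖ₑ ^ p ∂(Measure.pi ν)
      ≤ momentConst p * mcRate p P := by
  have hP0 : (0 : ℝ) < P := by exact_mod_cast hP
  have hs : 0 < √(P : ℝ) := Real.sqrt_pos.2 hP0
  have hss : √(P : ℝ) * √(P : ℝ) = P := Real.mul_self_sqrt hP0.le
  have hsub := hasSubgaussianMGF_sum_sub_integral ν hg hg1
  set Z : (Fin P → X) → ℝ := fun y => ∑ j, (g (y j) - ∫ x, g x ∂ν j) with hZ
  set t : ℝ := (√(P : ℝ))⁻¹ with ht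
  have htx : ∀ y, √(P : ℝ) * (Z y / P) = t * Z y := fun y => by
    rw [mul_div_left_comm, mul_comm, ht]
    congr 1
    rw [div_eq_iff hP0.ne', eq_inv_mul_iff_mul_eq₀ hs.ne', hss]
  have hc : (p / √(P : ℝ)) ^ p = p ^ p * t ^ p := by
    rw [div_eq_mul_inv, Real.mul_rpow hp.le (by positivity)]
  have hexp : ∀ s : ℝ, s ^ 2 = t ^ 2 →
      ∫ y, Real.exp (s * Z y) ∂(Measure.pi ν) ≤ Real.exp (1 / 2) := fun s hst => by
    refine (hsub.mgf_le s).trans_eq ?_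
    have h1 : (P : ℝ) * s ^ 2 = 1 := by
      rw [hst, ht, inv_pow, Real.sq_sqrt hP0.le, mul_inv_cancel₀ hP0.ne']
    simp [h1]
  have hpt : ∀ y : Fin P → X, ‖(∑ j, g (y j)) / P - (∑ j, ∫ x, g x ∂ν j) / P‖ₑ ^ p
      ≤ ENNReal.ofReal (p ^ p * t ^ p * (Real.exp (t * Z y) + Real.exp (-t * Z y))) := by
    intro y
    have hy : (∑ j, g (y j)) / P - (∑ j, ∫ x, g x ∂ν j) / P = Z y / P := by
      simp only [hZ, Finset.sum_sub_distrib, sub_div]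
    rw [hy, Real.enorm_eq_ofReal_abs, ENNReal.ofReal_rpow_of_nonneg (abs_nonneg _) hp.le]
    refine ENNReal.ofReal_le_ofReal ?_
    have h := rpow_abs_le_mul_max_exp (Z y / P) hp.le hs.ne'
    rw [abs_of_pos hs, hc, neg_mul, htx, ← neg_mul] at h
    exact h.trans (mul_le_mul_of_nonneg_left
      (max_le_add_of_nonneg (Real.exp_pos _).le (Real.exp_pos _).le) (by positivity))
  refine (lintegral_mono hpt).trans ?_
  rw [← ofReal_integral_eq_lintegral_ofReal
    (f := fun y => p ^ p * t ^ p * (Real.exp (t * Z y) + Real.exp (-t * Z y)))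
    (((hsub.integrable_exp_mul t).add (hsub.integrable_exp_mul (-t))).const_mul _)
    (.of_forall fun y => by positivity), integral_const_mul,
    integral_add (hsub.integrable_exp_mul t) (hsub.integrable_exp_mul (-t)), mcRate, momentConst,
    ← ENNReal.ofReal, ← ENNReal.ofReal_mul (by positivity)]
  refine ENNReal.ofReal_le_ofReal ?_
  have h1 := hexp t rfl
  have h2 := hexp (-t) (neg_sq t)
  calc p ^ p * t ^ p * (_ + _) ≤ p ^ p * t ^ p * (Real.exp (1 / 2) + Real.exp (1 / 2)) := by
        gcongr
    _ = _ := by ring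

end Moment

/-! ### The relaxed posterior as a conditional law -/

section Posterior

variable {X 𝒜 : Type*} [MeasurableSpace X] [NormedAddCommGroup 𝒜]

theorem relaxWeight_indicatorPhi {a : 𝒜} {δ : ℝ≥0∞} (hδ : 0 < δ) (b : 𝒜) :
    relaxWeight indicatorPhi a δ b = {b : 𝒜 | ‖b - a‖ₑ < δ}.indicator 1 b := by
  have hfin : ‖b - a‖ₑ / δ ≠ ∞ := ENNReal.div_ne_top enorm_ne_top hδ.ne'
  have hiff : (‖b - a‖ₑ / δ).toNNReal < 1 ↔ ‖b - a‖ₑ < δ := by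
    rw [← ENNReal.coe_lt_coe, ENNReal.coe_toNNReal hfin, ENNReal.coe_one,
      ENNReal.div_lt_iff (.inl hδ.ne') (.inr enorm_ne_top), one_mul]
  simp only [relaxWeight, indicatorPhi, Set.indicator, hiff, Set.mem_ofPred_eq, Pi.one_apply]
  split_ifs <;> rfl

/-- For the indicator relaxation function the relaxed posterior is `μ` conditioned on
the data ball. -/
theorem relaxedPosterior_indicatorPhi_eq_cond [MeasurableSpace 𝒜] [BorelSpace 𝒜]
    (μ : Measure X) {A : X → 𝒜} (hA : Measurable A)
    (a : 𝒜) {δ : ℝ≥0∞} (hδ : 0 < δ) :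
    relaxedPosterior indicatorPhi μ A a δ = μ[|dataBall A a δ] := by
  have hball : MeasurableSet {b : 𝒜 | ‖b - a‖ₑ < δ} := measurableSet_dataBall measurable_id a δ
  have hZ : normConst indicatorPhi μ A a δ = μ (dataBall A a δ) := by
    simp only [normConst, relaxWeight_indicatorPhi hδ]
    rw [lintegral_indicator_one hball, Measure.map_apply hA hball]
    rfl
  have hw : (fun x => relaxWeight indicatorPhi a δ (A x)) = (dataBall A a δ).indicator 1 := by
    funext x
    rw [relaxWeight_indicatorPhi hδ]
    rfl
  rw [relaxedPosterior, hZ, hw, withDensity_indicator_one (measurableSet_dataBall hA a δ)]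
  rfl

end Posterior

/-! ### The ratio estimator -/

section Ratio

variable {X : Type*} {P : ℕ}

theorem abs_indicator_le_one {S : Set X} {g : X → ℝ} (hg1 : ∀ x, |g x| ≤ 1) (x : X) :
    |S.indicator g x| ≤ 1 :=
  (norm_indicator_le_norm_self (f := g) (s := S) x).trans (hg1 x)

theorem abs_smcEstimate_indicator_le (S : Set X) {f : X → ℝ} (hf1 : ∀ x, |f x| ≤ 1)
    (y : Fin P → X) :
    |smcEstimate (S.indicator f) (.inr y : State X P)|
      ≤ smcEstimate (S.indicator 1) (.inr y : State X P) := by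
  simp only [smcEstimate]
  rw [abs_div, Nat.abs_cast]
  gcongr
  refine (Finset.abs_sum_le_sum_abs _ _).trans (Finset.sum_le_sum fun j _ => ?_)
  by_cases hj : y j ∈ S <;> simp [hj, hf1]

/-- The error of the ratio estimator is controlled by the errors of its numerator and denominator.
No lower bound on the empirical denominator is needed, as a ratio of empirical means is at
most `1` in absolute value. The case `b' = 0` is included: then `a' = 0` and the ratio is `0`. -/
theorem abs_ratio_sub_le {a' b' a b : ℝ} (hab : |a'| ≤ b') (hb : 0 < b) :
    |a' / b' - a / b| ≤ b⁻¹ * (|a' - a| + |b' - b|) := by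
  have hr : |a' / b'| ≤ 1 := by
    rw [abs_div]
    exact div_le_one_of_le₀ (hab.trans (le_abs_self _)) (abs_nonneg _)
  have ha : a' / b' * b' = a' := by
    refine div_mul_cancel_of_imp fun h => ?_
    exact abs_nonpos_iff.1 (hab.trans h.le)
  have heq : a' / b' - a / b = b⁻¹ * ((a' - a) - a' / b' * (b' - b)) := by
    rw [mul_sub (a' / b'), ha]
    field_simp
    ring
  rw [heq, abs_mul, abs_of_pos (inv_pos.2 hb)]
  refine mul_le_mul_of_nonneg_left ((abs_sub _ _).trans (add_le_add le_rfl ?_)) (inv_pos.2 hb).le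
  rw [abs_mul]
  exact mul_le_of_le_one_left (abs_nonneg _) hr

end Ratio

/-! ### The two steps of an iteration -/

section Step

variable {X : Type*} [MeasurableSpace X] {P : ℕ}

theorem measurable_smcEstimate {f : X → ℝ} (hf : Measurable f) :
    Measurable (smcEstimate f : State X P → ℝ) := by
  refine measurable_fun_sum measurable_const ?_
  change Measurable fun x : Fin P → X => (∑ j, f (x j)) / P
  fun_prop

theorem measurable_enorm_smcEstimate_sub_rpow {f : X → ℝ} (hf : Measurable f) (b p : ℝ) :
    Measurable fun s : State X P => ‖smcEstimate f s - b‖ₑ ^ p :=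
  ((measurable_smcEstimate hf).sub_const b).enorm.pow_const p

open scoped Classical in
theorem isProbabilityMeasure_resampleLaw {S : Set X} {y : Fin P → X} (hy : ∃ k, y k ∈ S)
    (j : Fin P) : IsProbabilityMeasure (resampleLaw S y j) := by
  unfold resampleLaw
  split_ifs
  · infer_instance
  · obtain ⟨k, hk⟩ := hy
    have hne : (survivors S y).card ≠ 0 :=
      Finset.card_ne_zero_of_mem (a := k) (by simpa [survivors] using hk)
    refine ⟨?_⟩
    simp only [Measure.smul_apply, Measure.finsetSum_apply, measure_univ, Finset.sum_const,
      smul_eq_mul, nsmul_eq_mul, mul_one]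
    exact ENNReal.inv_mul_cancel (by exact_mod_cast hne) (ENNReal.natCast_ne_top _)

instance (S : Set X) (hS : MeasurableSet S) : IsMarkovKernel (selectKernel P S hS) := by
  classical
  refine ⟨fun y => ?_⟩
  rw [selectKernel, Kernel.piecewise_apply]
  split_ifs with hy
  · have := fun j => isProbabilityMeasure_resampleLaw hy j
    rw [Kernel.map_apply _ measurable_inr]
    have : IsProbabilityMeasure (resampleKernel P S hS y) :=
      inferInstanceAs (IsProbabilityMeasure (Measure.pi fun j => resampleLaw S y j))
    exact Measure.isProbabilityMeasure_map measurable_inr.aemeasurable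
  · rw [Kernel.const_apply]
    infer_instance

instance (K : Kernel X X) [IsMarkovKernel K] : IsMarkovKernel (moveKernel P K) :=
  ⟨fun x => inferInstanceAs (IsProbabilityMeasure (Measure.pi fun j => K (x j)))⟩

instance (K : Kernel X X) [IsMarkovKernel K] (S : Set X) (hS : MeasurableSet S) :
    IsMarkovKernel (stepKernel P K S hS) := by
  refine ⟨?_⟩
  rintro (u | x)
  · exact inferInstanceAs (IsProbabilityMeasure (Measure.dirac _))
  · exact inferInstanceAs
      (IsProbabilityMeasure ((selectKernel P S hS ∘ₖ moveKernel P K) x))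

open scoped Classical in
/-- The mean of the re-sampled empirical measure is the empirical measure of the population
conditioned on `S`. -/
theorem sum_integral_resampleLaw (S : Set X) {y : Fin P → X} (hy : ∃ k, y k ∈ S) {f : X → ℝ}
    (hf : Measurable f) :
    (∑ j, ∫ x, f x ∂(resampleLaw S y j)) / P
      = smcEstimate (S.indicator f) (.inr y) / smcEstimate (S.indicator 1) (.inr y) := by
  obtain ⟨k, hk⟩ := hy
  have hne : (survivors S y).card ≠ 0 :=
    Finset.card_ne_zero_of_mem (a := k) (by simpa [survivors] using hk)
  have hN : ((survivors S y).card : ℝ) ≠ 0 := by exact_mod_cast hne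
  have hP : (P : ℝ) ≠ 0 := by exact_mod_cast (Fin.pos k).ne'
  set T : ℝ := ∑ k ∈ survivors S y, f (y k) with hT
  have hlaw : ∀ j, ∫ x, f x ∂(resampleLaw S y j)
      = S.indicator f (y j) + (1 - S.indicator 1 (y j)) * (T / (survivors S y).card) := by
    intro j
    unfold resampleLaw
    split_ifs with hj
    · simp [hj, integral_dirac' _ _ hf.stronglyMeasurable]
    · rw [integral_smul_measure, integral_finsetSum_measure fun k _ =>
        integrable_dirac' hf.stronglyMeasurable (by simp)]
      simp [hj, integral_dirac' _ _ hf.stronglyMeasurable, hT, div_eq_inv_mul]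
  have hnum : ∑ j, S.indicator f (y j) = T := by
    simp [hT, survivors, Finset.sum_filter, Set.indicator_apply]
  have hden : ∑ j, S.indicator (1 : X → ℝ) (y j) = (survivors S y).card := by
    simp [survivors, Set.indicator_apply]
  simp only [smcEstimate, hlaw, Finset.sum_add_distrib, ← Finset.sum_mul,
    Finset.sum_sub_distrib, hnum, hden]
  simp
  field_simp
  ring

/-- Selection moves the estimate away from the empirical measure conditioned on `S` by a
fluctuation of Monte Carlo order. If no particle lies in `S`, then the estimate and the quotient
`0 / 0` both vanish. -/
theorem lintegral_selectKernel_le (hP : 0 < P) {S : Set X} (hS : MeasurableSet S) (y : Fin P → X)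
    {f : X → ℝ} (hf : Measurable f) (hf1 : ∀ x, |f x| ≤ 1) {p : ℝ} (hp : 0 < p) :
    ∫⁻ s, ‖smcEstimate f s
        - smcEstimate (S.indicator f) (.inr y : State X P)
          / smcEstimate (S.indicator 1) (.inr y : State X P)‖ₑ ^ p ∂(selectKernel P S hS y)
      ≤ momentConst p * mcRate p P := by
  classical
  rw [selectKernel, Kernel.piecewise_apply]
  split_ifs with hy
  · have := fun j => isProbabilityMeasure_resampleLaw hy j
    rw [Kernel.map_apply _ measurable_inr, lintegral_map
      (measurable_enorm_smcEstimate_sub_rpow hf _ p) measurable_inr,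
      ← sum_integral_resampleLaw S hy hf]
    exact lintegral_mean_sub_rpow_le hP (resampleLaw S y) hf hf1 hp
  · have hy' : ∀ j, y j ∉ S := by simpa using hy
    rw [Kernel.const_apply, lintegral_dirac' _ (measurable_enorm_smcEstimate_sub_rpow hf _ p)]
    simp [smcEstimate, hy', ENNReal.zero_rpow_of_pos hp]

/-- A move step increases the `p`-th power error of the estimate of `b` by a fluctuation of Monte
Carlo order, and replaces the integrand by its image under the kernel. -/
theorem lintegral_moveKernel_le (hP : 0 < P) (K : Kernel X X) [IsMarkovKernel K] (x : Fin P → X)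
    {g : X → ℝ} (hg : Measurable g) (hg1 : ∀ x, |g x| ≤ 1) {p : ℝ} (hp : 1 ≤ p) (b : ℝ) :
    ∫⁻ y, ‖smcEstimate g (.inr y : State X P) - b‖ₑ ^ p ∂(moveKernel P K x)
      ≤ 2 ^ (p - 1) * (momentConst p * mcRate p P
        + ‖smcEstimate (fun x => ∫ z, g z ∂(K x)) (.inr x : State X P) - b‖ₑ ^ p) := by
  set c := smcEstimate (fun x => ∫ z, g z ∂(K x)) (.inr x : State X P) with hc
  have hpt : ∀ y : Fin P → X, ‖smcEstimate g (.inr y : State X P) - b‖ₑ ^ p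
      ≤ 2 ^ (p - 1) * (‖smcEstimate g (.inr y : State X P) - c‖ₑ ^ p + ‖c - b‖ₑ ^ p) := by
    intro y
    rw [← sub_add_sub_cancel _ c b]
    exact (ENNReal.rpow_le_rpow (enorm_add_le _ _) (by linarith)).trans
      (ENNReal.rpow_add_le_mul_rpow_add_rpow _ _ hp)
  have hm : Measurable fun y : Fin P → X => ‖smcEstimate g (.inr y : State X P) - c‖ₑ ^ p :=
    (measurable_enorm_smcEstimate_sub_rpow hg c p).comp measurable_inr
  refine (lintegral_mono hpt).trans ?_
  rw [lintegral_const_mul _ (hm.add_const _), lintegral_add_left hm, lintegral_const,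
    measure_univ, mul_one]
  gcongr
  exact lintegral_mean_sub_rpow_le hP (fun j => K (x j)) hg hg1 (by linarith)

end Step

/-! ### Propagation of the error through the ladder -/

section Propagation

variable {X : Type*} [MeasurableSpace X] {P : ℕ}

theorem integral_integral_of_invariant {K : Kernel X X} {π : Measure X} [IsFiniteMeasure π]
    (hK : Kernel.Invariant K π) {g : X → ℝ} (hg : Measurable g) (hg1 : ∀ x, |g x| ≤ 1) :
    ∫ x, ∫ z, g z ∂(K x) ∂π = ∫ x, g x ∂π := by
  have hcomp : (K ∘ₖ Kernel.const Unit π) () = π := by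
    rw [Kernel.comp_apply, Kernel.const_apply]
    exact hK
  have hint : Integrable g ((K ∘ₖ Kernel.const Unit π) ()) := by
    rw [hcomp]
    exact integrable_of_abs_le_one hg hg1
  have h := Kernel.integral_comp hint
  rw [hcomp, Kernel.const_apply] at h
  exact h.symm

theorem integral_cond_eq_div {π : Measure X} {S : Set X} (hS : MeasurableSet S) (f : X → ℝ) :
    ∫ x, f x ∂(π[|S]) = (∫ x, S.indicator f x ∂π) / (∫ x, S.indicator 1 x ∂π) := by
  rw [integral_indicator hS, integral_indicator_one hS, ProbabilityTheory.cond, integral_smul_measure,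
    ENNReal.toReal_inv, smul_eq_mul, div_eq_inv_mul]
  rfl

/-- The constant for the `p`-th power error after an iteration, in terms of the constant `D`
before it and of the probability `ρ` that the next level has under the current target. -/
noncomputable def stepConst (p : ℝ) (ρ D : ℝ≥0∞) : ℝ≥0∞ :=
  2 ^ (p - 1) * (momentConst p
    + ρ⁻¹ ^ p * (2 ^ (p - 1) * (2 ^ (p - 1) * (momentConst p + D)
      + 2 ^ (p - 1) * (momentConst p + D)))) + D

theorem stepConst_ne_top {p : ℝ} (hp : 1 ≤ p) {ρ D : ℝ≥0∞} (hρ : ρ ≠ 0) (hD : D ≠ ∞) :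
    stepConst p ρ D ≠ ∞ := by
  have h2 : (2 : ℝ≥0∞) ^ (p - 1) ≠ ∞ := ENNReal.rpow_ne_top_of_nonneg (by linarith) (by simp)
  have hr : ρ⁻¹ ^ p ≠ ∞ := ENNReal.rpow_ne_top_of_nonneg (by linarith) (by simpa using hρ)
  unfold stepConst
  finiteness

/-- The error after one iteration from a given state, in terms of the errors in that state. A state
of failure has error `1` for the constant integrand `1`, which accounts for the last term. -/
theorem lintegral_stepKernel_le (hP : 0 < P) {K : Kernel X X} [IsMarkovKernel K]
    {π : Measure X} [IsProbabilityMeasure π] {S : Set X} (hS : MeasurableSet S) (hπS : π S ≠ 0)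
    (hK : Kernel.Invariant K π) {f : X → ℝ} (hf : Measurable f) (hf1 : ∀ x, |f x| ≤ 1)
    {p : ℝ} (hp : 1 ≤ p) (s : State X P) :
    ∫⁻ s', ‖smcEstimate f s' - ∫ x, f x ∂(π[|S])‖ₑ ^ p ∂(stepKernel P K S hS s)
      ≤ 2 ^ (p - 1) * (momentConst p * mcRate p P
          + (π S)⁻¹ ^ p * (2 ^ (p - 1)
            * (2 ^ (p - 1) * (momentConst p * mcRate p P
                + ‖smcEstimate (fun x => ∫ z, S.indicator f z ∂(K x)) s
                  - ∫ x, ∫ z, S.indicator f z ∂(K x) ∂π‖ₑ ^ p)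
              + 2 ^ (p - 1) * (momentConst p * mcRate p P
                + ‖smcEstimate (fun x => ∫ z, S.indicator 1 z ∂(K x)) s
                  - ∫ x, ∫ z, S.indicator 1 z ∂(K x) ∂π‖ₑ ^ p))))
        + ‖smcEstimate (fun _ => 1) s - ∫ _, (1 : ℝ) ∂π‖ₑ ^ p := by
  have hp0 : 0 < p := by linarith
  have hprob : IsProbabilityMeasure (π[|S]) := cond_isProbabilityMeasure hπS
  have hSf : Measurable (S.indicator f) := hf.indicator hS
  have hSf1 := abs_indicator_le_one (S := S) hf1
  have hS1 : Measurable (S.indicator (1 : X → ℝ)) := measurable_one.indicator hS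
  have hS11 : ∀ x, |S.indicator (1 : X → ℝ) x| ≤ 1 := abs_indicator_le_one fun _ => by simp
  rcases s with u | x
  · refine le_trans ?_ le_add_self
    change ∫⁻ s', _ ∂(Measure.dirac (Sum.inl ())) ≤ _
    rw [lintegral_dirac' _ (measurable_enorm_smcEstimate_sub_rpow hf _ p)]
    have h1 : ‖(0 : ℝ) - ∫ x, f x ∂(π[|S])‖ₑ ≤ 1 := by
      rw [zero_sub, enorm_neg, Real.enorm_eq_ofReal_abs, ← ENNReal.ofReal_one]
      exact ENNReal.ofReal_le_ofReal (abs_integral_le_one hf1)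
    simpa [smcEstimate] using ENNReal.rpow_le_one h1 hp0.le
  refine le_trans ?_ le_self_add
  rw [integral_integral_of_invariant hK hSf hSf1, integral_integral_of_invariant hK hS1 hS11,
    integral_cond_eq_div hS]
  set a := ∫ x, S.indicator f x ∂π
  set b : ℝ := ∫ x, S.indicator 1 x ∂π with hb
  have hbS : b = (π S).toReal := by
    rw [hb, integral_indicator_one hS]
    rfl
  have hb0 : 0 < b := hbS ▸ ENNReal.toReal_pos hπS (measure_ne_top _ _)
  have hinv : ENNReal.ofReal b⁻¹ = (π S)⁻¹ := by
    rw [ENNReal.ofReal_inv_of_pos hb0, hbS, ENNReal.ofReal_toReal (measure_ne_top _ _)]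
  let N (y : Fin P → X) : ℝ := smcEstimate (S.indicator f) (.inr y : State X P)
  let D (y : Fin P → X) : ℝ := smcEstimate (S.indicator 1) (.inr y : State X P)
  have hNm : Measurable fun y => ‖N y - a‖ₑ ^ p :=
    (measurable_enorm_smcEstimate_sub_rpow hSf a p).comp measurable_inr
  have hDm : Measurable fun y => ‖D y - b‖ₑ ^ p :=
    (measurable_enorm_smcEstimate_sub_rpow hS1 b p).comp measurable_inr
  have hratio : ∀ y, ‖N y / D y - a / b‖ₑ ^ p
      ≤ (π S)⁻¹ ^ p * (2 ^ (p - 1) * (‖N y - a‖ₑ ^ p + ‖D y - b‖ₑ ^ p)) := by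
    intro y
    have h : ‖N y / D y - a / b‖ₑ ≤ (π S)⁻¹ * (‖N y - a‖ₑ + ‖D y - b‖ₑ) := by
      rw [← hinv]
      simp only [Real.enorm_eq_ofReal_abs]
      rw [← ENNReal.ofReal_add (abs_nonneg _) (abs_nonneg _),
        ← ENNReal.ofReal_mul (inv_pos.2 hb0).le]
      exact ENNReal.ofReal_le_ofReal
        (abs_ratio_sub_le (abs_smcEstimate_indicator_le S hf1 y) hb0)
    refine (ENNReal.rpow_le_rpow h hp0.le).trans ?_
    rw [ENNReal.mul_rpow_of_nonneg _ _ hp0.le]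
    gcongr
    exact ENNReal.rpow_add_le_mul_rpow_add_rpow _ _ hp
  have hsel : ∀ y, ∫⁻ s', ‖smcEstimate f s' - a / b‖ₑ ^ p ∂(selectKernel P S hS y)
      ≤ 2 ^ (p - 1) * (momentConst p * mcRate p P
        + (π S)⁻¹ ^ p * (2 ^ (p - 1) * (‖N y - a‖ₑ ^ p + ‖D y - b‖ₑ ^ p))) := by
    intro y
    have hpt : ∀ s' : State X P, ‖smcEstimate f s' - a / b‖ₑ ^ p
        ≤ 2 ^ (p - 1) * (‖smcEstimate f s' - N y / D y‖ₑ ^ p + ‖N y / D y - a / b‖ₑ ^ p) := by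
      intro s'
      rw [← sub_add_sub_cancel _ (N y / D y) (a / b)]
      exact (ENNReal.rpow_le_rpow (enorm_add_le _ _) hp0.le).trans
        (ENNReal.rpow_add_le_mul_rpow_add_rpow _ _ hp)
    have hm := measurable_enorm_smcEstimate_sub_rpow (P := P) hf (N y / D y) p
    refine (lintegral_mono hpt).trans ?_
    rw [lintegral_const_mul _ (hm.add_const _), lintegral_add_left hm, lintegral_const,
      measure_univ, mul_one]
    gcongr
    · exact lintegral_selectKernel_le hP hS y hf hf1 hp0
    · exact hratio y
  change ∫⁻ s', _ ∂((selectKernel P S hS ∘ₖ moveKernel P K) x) ≤ _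
  rw [Kernel.lintegral_comp _ _ _ (measurable_enorm_smcEstimate_sub_rpow hf _ p)]
  refine (lintegral_mono hsel).trans ?_
  rw [lintegral_const_mul _ (by fun_prop), lintegral_add_left measurable_const, lintegral_const,
    measure_univ, mul_one, lintegral_const_mul _ (by fun_prop), lintegral_const_mul _ (by fun_prop),
    lintegral_add_left hNm]
  gcongr
  · exact lintegral_moveKernel_le hP K x hSf hSf1 hp a
  · exact lintegral_moveKernel_le hP K x hS1 hS11 hp b

/-- One iteration turns a uniform error bound for the target `π` into one for `π` conditioned
on `S`. -/
theorem lintegral_bind_stepKernel_le (hP : 0 < P) {K : Kernel X X} [IsMarkovKernel K]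
    {π : Measure X} [IsProbabilityMeasure π] {S : Set X} (hS : MeasurableSet S) (hπS : π S ≠ 0)
    (hK : Kernel.Invariant K π) {p : ℝ} (hp : 1 ≤ p) {law : Measure (State X P)}
    [IsProbabilityMeasure law] {D : ℝ≥0∞}
    (hlaw : ∀ g : X → ℝ, Measurable g → (∀ x, |g x| ≤ 1) →
      ∫⁻ s, ‖smcEstimate g s - ∫ x, g x ∂π‖ₑ ^ p ∂law ≤ D * mcRate p P)
    {f : X → ℝ} (hf : Measurable f) (hf1 : ∀ x, |f x| ≤ 1) :
    ∫⁻ s, ‖smcEstimate f s - ∫ x, f x ∂(π[|S])‖ₑ ^ p ∂(law.bind (stepKernel P K S hS))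
      ≤ stepConst p (π S) D * mcRate p P := by
  have hKm : ∀ g : X → ℝ, Measurable g → Measurable fun x => ∫ z, g z ∂(K x) :=
    fun g hg => hg.stronglyMeasurable.integral_kernel.measurable
  have hK1 : ∀ g : X → ℝ, (∀ x, |g x| ≤ 1) → ∀ x, |∫ z, g z ∂(K x)| ≤ 1 :=
    fun g hg1 x => abs_integral_le_one hg1
  have hSf : Measurable (S.indicator f) := hf.indicator hS
  have hS1 : Measurable (S.indicator (1 : X → ℝ)) := measurable_one.indicator hS
  have hm1 := measurable_enorm_smcEstimate_sub_rpow (P := P) (hKm _ hSf)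
    (∫ x, ∫ z, S.indicator f z ∂(K x) ∂π) p
  have hm2 := measurable_enorm_smcEstimate_sub_rpow (P := P) (hKm _ hS1)
    (∫ x, ∫ z, S.indicator 1 z ∂(K x) ∂π) p
  have hm3 := measurable_enorm_smcEstimate_sub_rpow (X := X) (P := P) (f := fun _ => 1)
    measurable_const (∫ _, (1 : ℝ) ∂π) p
  have h1 := hlaw _ (hKm _ hSf) (hK1 _ (abs_indicator_le_one hf1))
  have h2 := hlaw _ (hKm _ hS1) (hK1 _ (abs_indicator_le_one (by simp)))
  have h3 := hlaw (fun _ => 1) measurable_const (by simp)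
  rw [Measure.lintegral_bind (Kernel.aemeasurable _)
    (measurable_enorm_smcEstimate_sub_rpow hf _ p).aemeasurable]
  refine (lintegral_mono (lintegral_stepKernel_le hP hS hπS hK hf hf1 hp)).trans ?_
  rw [lintegral_add_right _ hm3, lintegral_const_mul _ (by fun_prop),
    lintegral_add_left measurable_const, lintegral_const, measure_univ, mul_one,
    lintegral_const_mul _ (by fun_prop), lintegral_const_mul _ (by fun_prop),
    lintegral_add_left (by fun_prop), lintegral_const_mul _ (by fun_prop),
    lintegral_const_mul _ (by fun_prop), lintegral_add_left measurable_const,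
    lintegral_add_left measurable_const, lintegral_const, measure_univ, mul_one]
  refine (add_le_add (mul_le_mul_right (add_le_add_right (mul_le_mul_right (mul_le_mul_right
    (add_le_add (mul_le_mul_right (add_le_add_right h1 _) _)
      (mul_le_mul_right (add_le_add_right h2 _) _)) _) _) _) _) h3).trans_eq ?_
  unfold stepConst
  ring

/-- A decreasing ladder of levels: the error is of Monte Carlo order at each level, with a constant
that does not depend on the kernels, on the number of particles, or on the integrand. -/
theorem exists_lintegral_smcLaw_le (μ : Measure X) [IsProbabilityMeasure μ] {m : ℕ}
    (S : Fin (m + 1) → Set X) (hS : ∀ i, MeasurableSet (S i)) (hS0 : S 0 = Set.univ)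
    (hmono : ∀ i : Fin m, S i.succ ⊆ S i.castSucc) {p : ℝ} (hp : 1 ≤ p) (i : Fin (m + 1)) :
    ∃ D : ℝ≥0∞, ∀ (K : Fin m → Kernel X X) [∀ i, IsMarkovKernel (K i)],
      (∀ i : Fin m, Kernel.Invariant (K i) (μ[|S i.castSucc])) →
      (∀ i : Fin m, ∀ x ∈ S i.castSucc, 0 < K i x (S i.succ)) →
      D ≠ ∞ ∧ μ (S i) ≠ 0 ∧ ∀ P : ℕ, 0 < P → IsProbabilityMeasure (smcLaw P μ K S hS i) ∧
        ∀ f : X → ℝ, Measurable f → (∀ x, |f x| ≤ 1) →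
          ∫⁻ s, ‖smcEstimate f s - ∫ x, f x ∂(μ[|S i])‖ₑ ^ p ∂(smcLaw P μ K S hS i)
            ≤ D * mcRate p P := by
  induction i using Fin.induction with
  | zero =>
    refine ⟨momentConst p, fun K _ _ _ => ⟨ENNReal.coe_ne_top, by simp [hS0], fun P hP => ?_⟩⟩
    have hlaw : smcLaw P μ K S hS 0 = (Measure.pi fun _ => μ).map Sum.inr := rfl
    rw [hlaw, hS0, cond_univ]
    refine ⟨Measure.isProbabilityMeasure_map measurable_inr.aemeasurable, fun f hf hf1 => ?_⟩
    have hP0 : (P : ℝ) ≠ 0 := by exact_mod_cast hP.ne'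
    have h := lintegral_mean_sub_rpow_le hP (fun _ => μ) hf hf1 (zero_lt_one.trans_le hp)
    rw [Finset.sum_const, Finset.card_univ, Fintype.card_fin, nsmul_eq_mul,
      mul_div_cancel_left₀ _ hP0] at h
    rwa [lintegral_map (measurable_enorm_smcEstimate_sub_rpow hf _ p) measurable_inr]
  | succ i ih =>
    obtain ⟨D, hD⟩ := ih
    refine ⟨stepConst p (μ[|S i.castSucc] (S i.succ)) D, fun K _ hinv hreach => ?_⟩
    obtain ⟨hDtop, hμ, hlaw⟩ := hD K hinv hreach
    have hprob : IsProbabilityMeasure (μ[|S i.castSucc]) := cond_isProbabilityMeasure hμ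
    have hcond : μ[|S i.castSucc][|S i.succ] = μ[|S i.succ] := by
      rw [cond_cond_eq_cond_inter (hS _) (hS _), Set.inter_eq_right.2 (hmono i)]
    -- The invariant law charges the next level, which is reached from almost all of its states.
    have hρ : μ[|S i.castSucc] (S i.succ) ≠ 0 := by
      intro h0
      have hbind : (μ[|S i.castSucc]).bind (K i) (S i.succ) = 0 := by rwa [hinv i]
      rw [Measure.bind_apply (hS _) (Kernel.aemeasurable _),
        lintegral_eq_zero_iff ((K i).measurable_coe (hS _))] at hbind
      have hmem : ∀ᵐ x ∂(μ[|S i.castSucc]), x ∈ S i.castSucc := ae_cond_mem (hS _)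
      obtain ⟨x, hx0, hx⟩ := (hbind.and hmem).exists
      exact (hreach i x hx).ne' hx0
    refine ⟨stepConst_ne_top hp hρ hDtop, ?_, fun P hP => ?_⟩
    · intro h0
      exact hρ (cond_absolutelyContinuous h0)
    obtain ⟨hlawp, herr⟩ := hlaw P hP
    have hsucc : smcLaw P μ K S hS i.succ
        = (smcLaw P μ K S hS i.castSucc).bind (stepKernel P (K i) (S i.succ) (hS i.succ)) :=
      Fin.induction_succ _ _ i
    rw [hsucc]
    refine ⟨inferInstance, fun f hf hf1 => ?_⟩
    rw [← hcond]
    exact lintegral_bind_stepKernel_le hP (hS _) hρ (hinv i) hp herr hf hf1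

end Propagation

/-! ### From the unit ball to the normed space of test functions -/

section Scaling

variable {X : Type*} [MeasurableSpace X] {P : ℕ}

theorem mcRate_rpow_one_div {p : ℝ} (hp : 0 < p) (P : ℕ) :
    (mcRate p P).toReal ^ (1 / p) = (√(P : ℝ))⁻¹ := by
  rw [mcRate, ENNReal.toReal_ofReal (by positivity), one_div,
    Real.rpow_rpow_inv (by positivity) hp.ne']

/-- A power error bound over the unit ball of the bounded functions gives, for an integrand bounded
by `M`, an `L^p` error bound proportional to `M`. -/
theorem integral_rpow_le_of_lintegral_le {p : ℝ} (hp : 1 ≤ p) {law : Measure (State X P)}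
    {π : Measure X} {D : ℝ≥0∞} (hD : D ≠ ∞)
    (herr : ∀ g : X → ℝ, Measurable g → (∀ x, |g x| ≤ 1) →
      ∫⁻ s, ‖smcEstimate g s - ∫ x, g x ∂π‖ₑ ^ p ∂law ≤ D * mcRate p P)
    {f : X → ℝ} (hf : Measurable f) {M : ℝ} (hM : 0 ≤ M) (hfM : ∀ x, |f x| ≤ M) :
    Integrable (fun s => |smcEstimate f s - ∫ x, f x ∂π| ^ p) law ∧
      (∫ s, |smcEstimate f s - ∫ x, f x ∂π| ^ p ∂law) ^ (1 / p)
        ≤ D.toReal ^ (1 / p) * M / √(P : ℝ) := by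
  have hp0 : 0 < p := by linarith
  -- For `M = 0` the inverse is `0`, and `f = M * g` holds as `f = 0`.
  set g : X → ℝ := fun x => M⁻¹ * f x with hg_def
  have hgm : Measurable g := hf.const_mul _
  have hg1 : ∀ x, |g x| ≤ 1 := fun x => by
    rw [hg_def, abs_mul, abs_of_nonneg (inv_nonneg.2 hM)]
    exact (mul_le_mul_of_nonneg_left (hfM x) (inv_nonneg.2 hM)).trans inv_mul_le_one
  have hfg : f = fun x => M * g x := by
    funext x
    rcases hM.eq_or_lt with h0 | hpos
    · simpa [← h0] using hfM x
    · exact (mul_inv_cancel_left₀ hpos.ne' _).symm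
  have hlin : ∀ s : State X P, |smcEstimate f s - ∫ x, f x ∂π| ^ p
      = M ^ p * |smcEstimate g s - ∫ x, g x ∂π| ^ p := by
    intro s
    have hest : smcEstimate f s = M * smcEstimate g s := by
      rcases s with u | x
      · simp [smcEstimate]
      · rw [hfg]
        simp [smcEstimate, ← Finset.mul_sum, mul_div_assoc]
    have hint : ∫ x, f x ∂π = M * ∫ x, g x ∂π := by
      rw [hfg, integral_const_mul]
    rw [hest, hint, ← mul_sub, abs_mul, abs_of_nonneg hM, Real.mul_rpow hM (abs_nonneg _)]
  have hofReal : ∀ s : State X P, ENNReal.ofReal (|smcEstimate g s - ∫ x, g x ∂π| ^ p)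
      = ‖smcEstimate g s - ∫ x, g x ∂π‖ₑ ^ p := fun s => by
    rw [Real.enorm_eq_ofReal_abs, ENNReal.ofReal_rpow_of_nonneg (abs_nonneg _) hp0.le]
  have hmeas : Measurable fun s : State X P => |smcEstimate g s - ∫ x, g x ∂π| ^ p :=
    ((measurable_smcEstimate hgm).sub_const _).abs.pow_const p
  have hnonneg : ∀ s : State X P, 0 ≤ |smcEstimate g s - ∫ x, g x ∂π| ^ p := fun s => by
    positivity
  have hbound : D * mcRate p P ≠ ∞ := ENNReal.mul_ne_top hD ENNReal.ofReal_ne_top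
  have hle := herr g hgm hg1
  have hgint : Integrable (fun s => |smcEstimate g s - ∫ x, g x ∂π| ^ p) law := by
    refine ⟨hmeas.aestronglyMeasurable, ?_⟩
    rw [hasFiniteIntegral_iff_ofReal (.of_forall hnonneg)]
    simp only [hofReal]
    exact hle.trans_lt hbound.lt_top
  simp only [hlin]
  refine ⟨hgint.const_mul _, ?_⟩
  have hreal : ∫ s, |smcEstimate g s - ∫ x, g x ∂π| ^ p ∂law ≤ (D * mcRate p P).toReal := by
    rw [integral_eq_lintegral_of_nonneg_ae (.of_forall hnonneg) hmeas.aestronglyMeasurable]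
    simp only [hofReal]
    exact ENNReal.toReal_mono hbound hle
  have hI : 0 ≤ ∫ s, |smcEstimate g s - ∫ x, g x ∂π| ^ p ∂law := integral_nonneg hnonneg
  rw [integral_const_mul, Real.mul_rpow (by positivity) hI, one_div,
    Real.rpow_rpow_inv hM hp0.ne', ← one_div]
  calc M * (∫ s, |smcEstimate g s - ∫ x, g x ∂π| ^ p ∂law) ^ (1 / p)
      ≤ M * (D * mcRate p P).toReal ^ (1 / p) := by gcongr
    _ = D.toReal ^ (1 / p) * M / √(P : ℝ) := by
        rw [ENNReal.toReal_mul, Real.mul_rpow ENNReal.toReal_nonneg ENNReal.toReal_nonneg,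
          mcRate_rpow_one_div hp0]
        ring

end Scaling

end SMCND

theorem mainTheorem6
    {X 𝒜 : Type*} [MeasurableSpace X]
    [NormedAddCommGroup 𝒜] [MeasurableSpace 𝒜] [BorelSpace 𝒜]
    (μ : Measure X) [IsProbabilityMeasure μ]
    (A : X → 𝒜) (hA : Measurable A) (a : 𝒜)
    -- the ladder of bandwidths
    (m : ℕ) (δ : Fin (m + 1) → ℝ≥0∞)
    (hδ_zero : δ 0 = ∞) (hδ_anti : StrictAnti δ) (hδ_pos : ∀ i, 0 < δ i)
    -- the normed space of test functions
    (F : Submodule ℝ (X → ℝ)) (hF_meas : ∀ f ∈ F, Measurable f)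
    (normF : Seminorm ℝ F) (C_F : ℝ) (hF_sup : ∀ (f : F) (x : X), |(f : X → ℝ) x| ≤ C_F * normF f)
    (p : ℝ) (hp : 1 ≤ p) (ε : Fin m → ℝ) (hε : ∀ i, 0 < ε i) :
    ∃ C : ℝ, ∀ (K : Fin m → Kernel X X) [∀ i, IsMarkovKernel (K i)],
      -- invariance
      (∀ i : Fin m, Kernel.Invariant (K i)
        (SMCND.relaxedPosterior SMCND.indicatorPhi μ A a (δ i.castSucc))) →
      -- reachability
      (∀ i : Fin m, ∀ x ∈ SMCND.dataBall A a (δ i.castSucc),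
        0 < K i x (SMCND.dataBall A a (δ i.succ))) →
      -- minorisation
      (∀ i : Fin m, ∀ x ∈ SMCND.dataBall A a (δ i.castSucc),
        ∀ y ∈ SMCND.dataBall A a (δ i.castSucc),
          K i x ≪ K i y ∧
          ∀ᵐ z ∂(K i y), ENNReal.ofReal (ε i) ≤ (K i x).rnDeriv (K i y) z) →
      ∀ (P : ℕ), 0 < P → ∀ (f : F) (i : Fin (m + 1)),
        let law := SMCND.smcLaw P μ K (fun k => SMCND.dataBall A a (δ k))
          (fun k => SMCND.measurableSet_dataBall hA a (δ k))
        let target := ∫ x, (f : X → ℝ) x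
          ∂(SMCND.relaxedPosterior SMCND.indicatorPhi μ A a (δ i))
        Integrable (fun s => |SMCND.smcEstimate (f : X → ℝ) s - target| ^ p) (law i) ∧
        (∫ s, |SMCND.smcEstimate (f : X → ℝ) s - target| ^ p ∂(law i)) ^ (1 / p)
          ≤ C * normF f / √(P : ℝ) := by
  set S : Fin (m + 1) → Set X := fun k => SMCND.dataBall A a (δ k) with hS_def
  have hS : ∀ i, MeasurableSet (S i) := fun i => SMCND.measurableSet_dataBall hA a (δ i)
  have hS0 : S 0 = Set.univ := by
    ext x
    simp [S, SMCND.dataBall, hδ_zero]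
  have hmono : ∀ i : Fin m, S i.succ ⊆ S i.castSucc := fun i x hx =>
    lt_trans (show ‖A x - a‖ₑ < δ i.succ from hx) (hδ_anti Fin.castSucc_lt_succ)
  have hpost : ∀ i, SMCND.relaxedPosterior SMCND.indicatorPhi μ A a (δ i) = μ[|S i] := fun i =>
    SMCND.relaxedPosterior_indicatorPhi_eq_cond μ hA a (hδ_pos i)
  simp only [hpost]
  choose D hD using fun i => SMCND.exists_lintegral_smcLaw_le μ S hS hS0 hmono hp i
  -- The sum over the levels makes the constant uniform in the level.
  refine ⟨(∑ i, (D i).toReal ^ (1 / p)) * C_F, fun K _ hinv hreach _ P hP f i => ?_⟩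
  obtain ⟨hDtop, -, hlaw⟩ := hD i K hinv hreach
  obtain ⟨x₀⟩ : Nonempty X := nonempty_of_isProbabilityMeasure μ
  have hM : 0 ≤ C_F * normF f := (abs_nonneg _).trans (hF_sup f x₀)
  obtain ⟨hint, hle⟩ := SMCND.integral_rpow_le_of_lintegral_le hp hDtop (hlaw P hP).2
    (hF_meas f f.2) hM (hF_sup f)
  refine ⟨hint, hle.trans ?_⟩
  rw [mul_assoc]
  gcongr
  exact Finset.single_le_sum (f := fun i => (D i).toReal ^ (1 / p))
    (fun j _ => Real.rpow_nonneg ENNReal.toReal_nonneg _) (Finset.mem_univ i)
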